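/- Let $n\ge 3$, let $\mathcal V=\{1,\dots,n\}$, let $\mathcal G_0=(\mathcal V,\mathcal E_0)$ be a digraph, and let $A=[a_{ij}]\in\mathbb R^{n\times n}$ be a stochastic matrix (nonnegative entries, all row sums equal to $1$) such that $a_{ij}>0$ if and only if $(j,i)\in\mathcal E_0$. Let $(P_k^+)_{k\ge 0}$ and $(P_k^-)_{k\ge 0}$ be sequences in $[0,1]$. Consider the following randomized gossip algorithm. At each time $k\ge 0$ a node $i$ is drawn with probability $1/n$ and picks the pair $(i,j)$ with probability $a_{ij}$. At time $k$ let $\mathbb E_k^+$ be the event that the drawn node $i$ receives $x_j(k)$ and $\mathbb E_k^-$ the event that node $j$ receives $x_i(k)$, with $\mathbf P(\mathbb E_k^+)=P_k^+$ and $\mathbf P(\mathbb E_k^-)=P_k^-$; the selections and communications at different times are independent, and the communication is independent of the selection. Starting at time $k_0\ge 0$ (an arbitrary integer) from $x(k_0)=x^0\in\mathbb R^n$, when $(i,j)$ is selected at time $k\ge k_0$, node $i$ sets $x_i(k+1)=\frac12(x_i(k)+x_j(k))$ if $\mathbb E_k^+$ occurs, node $j$ sets $x_j(k+1)=\frac12(x_i(k)+x_j(k))$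 if $\mathbb E_k^-$ occurs, and all other values are kept. Global a.s. consensus is achieved if, for every $x^0\in\mathbb R^n$, $$\mathbf P\Big(\lim_{k\to\infty}\big(\max_i x_i(k)-\min_i x_i(k)\big)=0\Big)=1 .$$ Suppose that for every $k$ the events $\mathbb E_k^+$ and $\mathbb E_k^-$ are independent (independent communication), and that both $\mathcal G_0$ and its converse graph $\mathcal G_0^T$ (all arcs reversed) are quasi-strongly connected, i.e. each has a node from which every node is reachable along a directed path (double connectivity). Then, for every initial time $k_0$, global a.s. consensus is achieved if and only if $$\sum_{k=0}^\infty\big(P_k^++P_k^-\big)=\infty .$$ -/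

import Mathlib

open MeasureTheory ProbabilityTheory Filter Topology

namespace Gossip

/-! ### Digraphs -/

/-- The converse digraph, obtained by reversing the orientation of all arcs. -/
def converse {V : Type*} (G : Digraph V) : Digraph V where
  Adj i j := G.Adj j i

/-- Node `j` is reachable from node `i`: there is a directed path from `i` to `j`
(every node is reachable from itself). -/
def Reachable {V : Type*} (G : Digraph V) (i j : V) : Prop :=
  Relation.ReflTransGen G.Adj i j

/-- A digraph is quasi-strongly connected if it has a center, that is, a node from which every
node is reachable. -/
def QuasiStronglyConnected {V : Type*} (G : Digraph V) : Prop :=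
  ∃ c : V, ∀ v : V, Reachable G c v

/-- The digraph and its converse are both quasi-strongly connected. -/
def DoublyConnected {V : Type*} (G : Digraph V) : Prop :=
  QuasiStronglyConnected G ∧ QuasiStronglyConnected (converse G)

/-- `A` is a node pair selection matrix with underlying graph `G₀`: it is a (row) stochastic
matrix, and `a_ij > 0` exactly when `(j, i)` is an arc of `G₀`. -/
structure IsSelectionMatrix {n : ℕ} (G₀ : Digraph (Fin n)) (A : Matrix (Fin n) (Fin n) ℝ) :
    Prop where
  nonneg : ∀ i j, 0 ≤ A i j
  row_sum : ∀ i, ∑ j, A i j = 1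
  pos_iff : ∀ i j, 0 < A i j ↔ G₀.Adj j i

/-! ### The random environment -/

section Environment

variable {Ω : Type*} [MeasurableSpace Ω]

/-- The event that the transmission with success indicator `r` succeeds at time `k`. -/
def successEvent (r : ℕ → Ω → Bool) (k : ℕ) : Set Ω := {ω | r k ω = true}

/-- The node pair selection process and the node communication process.

* `sel k = (i, j)` means that at time `k` node `i` is drawn and picks the pair `(i, j)`: node `i`
  is drawn with probability `1 / n` and then picks `(i, j)` with probability `a_ij`.
* `rp k` is the indicator of the event `E⁺_k` that the drawn node `i` receives the value of `j`;
  it has probability `Pp k`.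
* `rm k` is the indicator of the event `E⁻_k` that the node `j` receives the value of `i`;
  it has probability `Pm k`.
* What happens at different times is independent, and the communication is independent of the
  selection. No assumption is made on the dependence between `E⁺_k` and `E⁻_k`. -/
structure IsGossipProcess {n : ℕ} (A : Matrix (Fin n) (Fin n) ℝ) (Pp Pm : ℕ → ℝ)
    (μ : Measure Ω) (sel : ℕ → Ω → Fin n × Fin n) (rp rm : ℕ → Ω → Bool) : Prop where
  measurable_sel : ∀ k, Measurable (sel k)
  measurable_rp : ∀ k, Measurable (rp k)
  measurable_rm : ∀ k, Measurable (rm k)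
  sel_law : ∀ k i j, μ.real {ω | sel k ω = (i, j)} = 1 / (n : ℝ) * A i j
  plus_law : ∀ k, μ.real (successEvent rp k) = Pp k
  minus_law : ∀ k, μ.real (successEvent rm k) = Pm k
  indep_time : iIndepFun (fun k ω => (sel k ω, rp k ω, rm k ω)) μ
  indep_sel_comm : ∀ k, IndepFun (sel k) (fun ω => (rp k ω, rm k ω)) μ

/-- Independent communication: for every `k`, the events `E⁺_k` and `E⁻_k` are independent. -/
def IndependentCommunication (μ : Measure Ω) (rp rm : ℕ → Ω → Bool) : Prop :=
  ∀ k, IndepSet (successEvent rp k) (successEvent rm k) μ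

end Environment

/-! ### The gossip algorithm -/

/-- One update when the pair `p = (i, j)` is selected: `i` moves to the average of the two values
if it receives the value of `j` (`a = true`), `j` moves to the average if it receives the value
of `i` (`b = true`), and all other values are kept. -/
noncomputable def step {n : ℕ} (p : Fin n × Fin n) (a b : Bool) (x : Fin n → ℝ) : Fin n → ℝ :=
  fun m =>
    if (m = p.1 ∧ a = true) ∨ (m = p.2 ∧ b = true) then (x p.1 + x p.2) / 2 else x m

/-- The state of the network `t` slots after the initial time `k₀`, that is `x(k₀ + t)`, along a
realization of the selection and the communication, with initial condition `x(k₀) = x0`. -/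
noncomputable def state {n : ℕ} (sel : ℕ → Fin n × Fin n) (rp rm : ℕ → Bool)
    (k₀ : ℕ) (x0 : Fin n → ℝ) : ℕ → Fin n → ℝ
  | 0 => x0
  | t + 1 => step (sel (k₀ + t)) (rp (k₀ + t)) (rm (k₀ + t)) (state sel rp rm k₀ x0 t)

/-- The consensus metric: the maximal minus the minimal value among all nodes. -/
noncomputable def spread {n : ℕ} (x : Fin n → ℝ) : ℝ := (⨆ i, x i) - (⨅ i, x i)

/-- Global a.s. consensus for the algorithm started at time `k₀`: for every initial condition,
the consensus metric tends to `0` with probability one. -/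
def GlobalASConsensus {n : ℕ} {Ω : Type*} [MeasurableSpace Ω] (μ : Measure Ω)
    (sel : ℕ → Ω → Fin n × Fin n) (rp rm : ℕ → Ω → Bool) (k₀ : ℕ) : Prop :=
  ∀ x0 : Fin n → ℝ, ∀ᵐ ω ∂μ,
    Tendsto (fun t => spread (state (fun k => sel k ω) (fun k => rp k ω) (fun k => rm k ω)
      k₀ x0 t)) atTop (𝓝 0)

end Gossip

/-!
The theorem holds because averaging never erases influence: an updated node keeps half of its own
value. Fix a node `r` and let `S` be the set of nodes whose value depends on that of `r`. Whatever
is selected and transmitted, `S` does not shrink, and the weight that its members give to `r` is at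
most halved by each successful transmission (`Influenced.interval`).

*Divergence implies consensus.* Cut the time axis into deterministic intervals in which the expected
number of transmissions `∑ (P⁺ + P⁻)` lies between `1` and `3`. In each of them one of the two
directions of transmission has expected number at least `1 / 2`; call it the direction of the
interval. Among `2 * n` consecutive intervals some direction occurs at least `n` times. By double
connectivity this direction has a center `r`, and starting from `{r}` one can prescribe, for each
interval, a pair whose selection, together with a successful transmission in the direction of the
interval, enlarges `S` until it contains all nodes (`exists_pairs_growing`). Within an interval the
prescribed pair is hit with probability bounded below, by the independence over time, and there are
at most `B` transmissions with probability close to `1`, by Markov's inequality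
(`IsGossipProcess.good_ge`). On the intersection of these events the spread contracts by a fixed
factor (`spread_contract`), and this intersection is independent of the past, so the expected spread
decays geometrically (`IsGossipProcess.exists_contraction`). As the spread is nonincreasing in time,
it tends to `0` almost surely.

*Consensus implies divergence.* If the series converges, then with positive probability a fixed pair
`(i, j)` is selected up to some time after which nothing is transmitted any more. As `n ≥ 3`, there
is a third node; if it starts at `1` and all others at `0`, the state never changes on this event
(`IsGossipProcess.exists_not_tendsto`).
-/

namespace Gossip

/-! ### Growth of the influenced set of nodes -/

/-- The node that is updated when a transmission along the selected pair `p` succeeds: the drawn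
node if `σ = true` (event `E⁺`), the picked node if `σ = false` (event `E⁻`). -/
def receiver {V : Type*} (σ : Bool) (p : V × V) : V := bif σ then p.1 else p.2

/-- The node whose value is transmitted along the selected pair `p`, in the direction `σ`. -/
def sender {V : Type*} (σ : Bool) (p : V × V) : V := bif σ then p.2 else p.1

/-- Along a directed path that leaves `S`, some arc leaves `S`. -/
theorem exists_rel_leaving {V : Type*} {R : V → V → Prop} {S : Finset V} {c v : V}
    (h : Relation.ReflTransGen R c v) (hc : c ∈ S) (hv : v ∉ S) :
    ∃ u w, R u w ∧ u ∈ S ∧ w ∉ S := by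
  induction h with
  | refl => exact absurd hc hv
  | @tail b d _ hbd ih =>
    by_cases hb : b ∈ S
    · exact ⟨b, d, hbd, hb, hv⟩
    · exact ih hb

/-- Under double connectivity, each of the two directions of transmission has a center, and so a
set containing it can be enlarged by an arc of positive weight as long as it is proper. -/
theorem exists_center {n : ℕ} {G₀ : Digraph (Fin n)} {A : Matrix (Fin n) (Fin n) ℝ}
    (hA : IsSelectionMatrix G₀ A) (hconn : DoublyConnected G₀) (σ : Bool) :
    ∃ c : Fin n, ∀ S : Finset (Fin n), c ∈ S → S ≠ Finset.univ →
      ∃ p : Fin n × Fin n, 0 < A p.1 p.2 ∧ sender σ p ∈ S ∧ receiver σ p ∉ S := by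
  have key : ∀ S : Finset (Fin n), S ≠ Finset.univ → ∃ v, v ∉ S := fun S hS => by
    by_contra! h
    exact hS (Finset.eq_univ_iff_forall.2 h)
  cases σ with
  | true =>
    obtain ⟨c, hc⟩ := hconn.1
    refine ⟨c, fun S hcS hS => ?_⟩
    obtain ⟨v, hv⟩ := key S hS
    obtain ⟨u, w, huw, hu, hw⟩ := exists_rel_leaving (hc v) hcS hv
    exact ⟨(w, u), (hA.pos_iff w u).2 huw, hu, hw⟩
  | false =>
    obtain ⟨c, hc⟩ := hconn.2
    refine ⟨c, fun S hcS hS => ?_⟩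
    obtain ⟨v, hv⟩ := key S hS
    obtain ⟨u, w, huw, hu, hw⟩ := exists_rel_leaving (hc v) hcS hv
    exact ⟨(u, w), (hA.pos_iff u w).2 huw, hu, hw⟩

theorem exists_pos_weight {n : ℕ} {G₀ : Digraph (Fin n)} {A : Matrix (Fin n) (Fin n) ℝ}
    (hA : IsSelectionMatrix G₀ A) (i : Fin n) : ∃ j, 0 < A i j := by
  by_contra! h
  have := hA.row_sum i
  have h2 : ∑ j, A i j ≤ 0 := Finset.sum_nonpos fun j _ => h j
  linarith

/-- Whatever the directions `τ` of the transmissions in `2 * n` rounds are, one may prescribe a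
root and the pairs selected in these rounds so that the root influences all nodes at the end. One
of the two directions occurs in at least `n` rounds: the root is the center for that direction,
and in each of those rounds the influenced set grows, unless it already is everything. -/
theorem exists_pairs_growing {n : ℕ} (hn : 0 < n) {G₀ : Digraph (Fin n)}
    {A : Matrix (Fin n) (Fin n) ℝ} (hA : IsSelectionMatrix G₀ A) (hconn : DoublyConnected G₀)
    (τ : ℕ → Bool) :
    ∃ (r : Fin n) (p : ℕ → Fin n × Fin n) (S : ℕ → Finset (Fin n)),
      (∀ l, 0 < A (p l).1 (p l).2) ∧ S 0 = {r} ∧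
      (∀ l, S (l + 1) = S l ∨
        (sender (τ l) (p l) ∈ S l ∧ S (l + 1) = insert (receiver (τ l) (p l)) (S l))) ∧
      S (2 * n) = Finset.univ := by
  classical
  obtain ⟨σ, hσ⟩ : ∃ σ, n ≤ ((Finset.range (2 * n)).filter fun l => τ l = σ).card := by
    by_contra! h
    have h1 := h true
    have h2 := h false
    have h3 := Finset.card_filter_add_card_filter_not (s := Finset.range (2 * n))
      (fun l => τ l = true)
    simp only [Bool.not_eq_true, Finset.card_range] at h3
    omega
  obtain ⟨c, hc⟩ := exists_center hA hconn σ
  have hf : ∀ S : Finset (Fin n), ∃ p : Fin n × Fin n, 0 < A p.1 p.2 ∧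
      (c ∈ S → S ≠ Finset.univ → sender σ p ∈ S ∧ receiver σ p ∉ S) := by
    intro S
    by_cases h : c ∈ S ∧ S ≠ Finset.univ
    · obtain ⟨p, hp, hp'⟩ := hc S h.1 h.2
      exact ⟨p, hp, fun _ _ => hp'⟩
    · obtain ⟨j, hj⟩ := exists_pos_weight hA ⟨0, hn⟩
      exact ⟨(⟨0, hn⟩, j), hj, fun h1 h2 => absurd ⟨h1, h2⟩ h⟩
  choose f hfpos hf using hf
  let S : ℕ → Finset (Fin n) := fun l => Nat.rec (motive := fun _ => Finset (Fin n)) {c} (fun l S =>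
    if τ l = σ ∧ sender σ (f S) ∈ S then insert (receiver σ (f S)) S else S) l
  have hS : ∀ l, S (l + 1) = if τ l = σ ∧ sender σ (f (S l)) ∈ S l then
    insert (receiver σ (f (S l))) (S l) else S l := fun l => rfl
  have hcS : ∀ l, c ∈ S l := by
    intro l
    induction l with
    | zero => exact Finset.mem_singleton_self c
    | succ l ih =>
      rw [hS]
      split_ifs
      · exact Finset.mem_insert_of_mem ih
      · exact ih
  have hcard : ∀ l, min n (((Finset.range l).filter fun l => τ l = σ).card) ≤ (S l).card := by
    intro l
    induction l with
    | zero => simp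
    | succ l ih =>
      rw [Finset.range_add_one, Finset.filter_insert, hS]
      by_cases h : τ l = σ
      · rw [if_pos h, Finset.card_insert_of_notMem (by simp)]
        by_cases hu : S l = Finset.univ
        · have : (S l).card = n := by rw [hu]; simp
          split_ifs
          · exact (min_le_left _ _).trans
              (this.symm.le.trans (Finset.card_le_card (Finset.subset_insert _ _)))
          · omega
        · obtain ⟨h1, h2⟩ := hf (S l) (hcS l) hu
          rw [if_pos ⟨h, h1⟩, Finset.card_insert_of_notMem h2]
          omega
      · rw [if_neg h, if_neg (fun h' => h h'.1)]
        exact ih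
  refine ⟨c, fun l => f (S l), S, fun l => hfpos _, rfl, fun l => ?_, ?_⟩
  · rw [hS]
    split_ifs with h
    · right
      rw [h.1]
      exact ⟨h.2, rfl⟩
    · left; rfl
  · refine Finset.eq_univ_of_card _ ?_
    have h1 := hcard (2 * n)
    have h2 := Finset.card_le_univ (S (2 * n))
    rw [Fintype.card_fin] at *
    omega

/-! ### Influence of a node along a realization -/

/-- The states `x` with all values in `[m, M]` such that the nodes in `S` give weight at least `c`
to the value `v`: their distance to either end of `[m, M]` is at least `c` times that of `v`. -/
def Influenced {V : Type*} (m M v c : ℝ) (S : Finset V) (x : V → ℝ) : Prop :=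
  (∀ i, m ≤ x i ∧ x i ≤ M) ∧ ∀ i ∈ S, m + c * (v - m) ≤ x i ∧ x i ≤ M - c * (M - v)

theorem Influenced.mono {V : Type*} {m M v c c' : ℝ} {S : Finset V} {x : V → ℝ}
    (h : Influenced m M v c S x) (hm : m ≤ v) (hM : v ≤ M) (hc : c' ≤ c) :
    Influenced m M v c' S x := by
  refine ⟨h.1, fun i hi => ?_⟩
  obtain ⟨h1, h2⟩ := h.2 i hi
  have h3 : c' * (v - m) ≤ c * (v - m) := mul_le_mul_of_nonneg_right hc (by linarith)
  have h4 : c' * (M - v) ≤ c * (M - v) := mul_le_mul_of_nonneg_right hc (by linarith)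
  constructor <;> linarith

theorem step_of_silent {n : ℕ} (p : Fin n × Fin n) {a b : Bool} (h : (a || b) = false)
    (x : Fin n → ℝ) : step p a b x = x := by
  simp only [Bool.or_eq_false_iff] at h
  funext i
  simp [step, h.1, h.2]

/-- One update enlarges the influenced set by the receiver of a successful transmission from an
influenced node. No node leaves the set, because every node keeps at least half of its value; for
the same reason the weight is at most halved. -/
theorem Influenced.step_insert {n : ℕ} {m M v c : ℝ} {S : Finset (Fin n)} {x : Fin n → ℝ}
    (h : Influenced m M v c S x) (hm : m ≤ v) (hM : v ≤ M) (hc : 0 ≤ c)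
    {p : Fin n × Fin n} {a b : Bool} {S' : Finset (Fin n)}
    (hS' : ∀ i ∈ S', i ∈ S ∨ ((i = p.1 ∧ a = true) ∨ (i = p.2 ∧ b = true)) ∧ (p.1 ∈ S ∨ p.2 ∈ S)) :
    Influenced m M v (c / 2) S' (step p a b x) := by
  have e1 := h.1 p.1
  have e2 := h.1 p.2
  have f1 : 0 ≤ c * (v - m) := mul_nonneg hc (by linarith)
  have f2 : 0 ≤ c * (M - v) := mul_nonneg hc (by linarith)
  refine ⟨fun i => ?_, fun i hi => ?_⟩
  · unfold step
    split_ifs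
    · constructor <;> linarith
    · exact h.1 i
  · unfold step
    split_ifs with hup
    · have hor : p.1 ∈ S ∨ p.2 ∈ S := by
        rcases hS' i hi with h' | h'
        · rcases hup with h'' | h''
          · exact .inl (h''.1 ▸ h')
          · exact .inr (h''.1 ▸ h')
        · exact h'.2
      rcases hor with h' | h' <;> have := h.2 _ h' <;> constructor <;> linarith
    · have := h.2 i ((hS' i hi).resolve_right fun h' => hup h'.1)
      constructor <;> linarith

/-- The number of times in `[T, T')` with a successful transmission. -/
def activity (a b : ℕ → Bool) (T T' : ℕ) : ℕ :=
  ((Finset.Ico T T').filter fun k => (a k || b k) = true).card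

theorem activity_succ (a b : ℕ → Bool) {T T' : ℕ} (h : T ≤ T') :
    activity a b T (T' + 1) = activity a b T T' + if (a T' || b T') = true then 1 else 0 := by
  unfold activity
  rw [← Finset.insert_Ico_right_eq_Ico_add_one h, Finset.filter_insert]
  split_ifs
  · rw [Finset.card_insert_of_notMem (by simp)]
  · rfl

/-- The times at which the pair `p` is selected and the transmission along it in the direction
`σ` succeeds. -/
def Hit {n : ℕ} (s : ℕ → Fin n × Fin n) (a b : ℕ → Bool) (σ : Bool) (p : Fin n × Fin n)
    (k : ℕ) : Prop :=
  s k = p ∧ (bif σ then a k else b k) = true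

/-- Silent updates change nothing, so over an interval of time the weight is halved at most as many
times as there are successful transmissions. -/
theorem Influenced.interval {n : ℕ} {m M v c : ℝ} {S : Finset (Fin n)}
    {s : ℕ → Fin n × Fin n} {a b : ℕ → Bool} {y : ℕ → Fin n → ℝ}
    (hy : ∀ t, y (t + 1) = step (s t) (a t) (b t) (y t))
    (hm : m ≤ v) (hM : v ≤ M) (hc : 0 ≤ c) {T T' : ℕ} (hT : T ≤ T')
    (h : Influenced m M v c S (y T)) (σ : Bool) (p : Fin n × Fin n) :
    Influenced m M v (c / 2 ^ activity a b T T') S (y T') ∧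
      (sender σ p ∈ S → (∃ k ∈ Finset.Ico T T', Hit s a b σ p k) →
        Influenced m M v (c / 2 ^ activity a b T T') (insert (receiver σ p) S) (y T')) := by
  induction T', hT using Nat.le_induction with
  | base => simpa [activity] using h
  | succ T' hT ih =>
    rw [activity_succ a b hT, hy]
    by_cases hab : (a T' || b T') = true
    · have hc' : 0 ≤ c / 2 ^ activity a b T T' := by positivity
      rw [if_pos hab, pow_succ, ← div_div]
      refine ⟨ih.1.step_insert hm hM hc' fun i hi => .inl hi, ?_⟩
      rintro hp ⟨k, hk, hhit⟩
      rw [Finset.mem_Ico, Nat.lt_succ_iff_lt_or_eq] at hk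
      obtain ⟨hk1, hk2 | rfl⟩ := hk
      · exact (ih.2 hp ⟨k, Finset.mem_Ico.2 ⟨hk1, hk2⟩, hhit⟩).step_insert hm hM hc' fun i hi => .inl hi
      · refine ih.1.step_insert hm hM hc' fun i hi => ?_
        obtain ⟨rfl, h2⟩ := hhit
        rw [Finset.mem_insert] at hi
        rcases hi with rfl | hi
        · right
          cases σ
          · exact ⟨.inr ⟨rfl, h2⟩, .inl hp⟩
          · exact ⟨.inl ⟨rfl, h2⟩, .inr hp⟩
        · exact .inl hi
    · rw [if_neg hab, add_zero, step_of_silent _ (by simpa using hab)]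
      refine ⟨ih.1, ?_⟩
      rintro hp ⟨k, hk, hhit⟩
      rw [Finset.mem_Ico, Nat.lt_succ_iff_lt_or_eq] at hk
      obtain ⟨hk1, hk2 | rfl⟩ := hk
      · exact ih.2 hp ⟨k, Finset.mem_Ico.2 ⟨hk1, hk2⟩, hhit⟩
      · exfalso
        obtain ⟨-, h2⟩ := hhit
        cases σ <;> simp_all

/-- The interval `[T, T')` is good for the pair `p` and the direction `σ`: `p` is hit, and there
are at most `B` successful transmissions. -/
def Good {n : ℕ} (s : ℕ → Fin n × Fin n) (a b : ℕ → Bool) (B : ℕ) (σ : Bool)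
    (p : Fin n × Fin n) (T T' : ℕ) : Prop :=
  (∃ k ∈ Finset.Ico T T', Hit s a b σ p k) ∧ activity a b T T' ≤ B

theorem bddAbove_range_fin {n : ℕ} (x : Fin n → ℝ) : BddAbove (Set.range x) :=
  (Set.finite_range x).bddAbove

theorem bddBelow_range_fin {n : ℕ} (x : Fin n → ℝ) : BddBelow (Set.range x) :=
  (Set.finite_range x).bddBelow

theorem spread_le {n : ℕ} (hn : 0 < n) {x : Fin n → ℝ} {m M : ℝ} (h : ∀ i, m ≤ x i ∧ x i ≤ M) :
    spread x ≤ M - m := by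
  have : Nonempty (Fin n) := ⟨⟨0, hn⟩⟩
  exact sub_le_sub (ciSup_le fun i => (h i).2) (le_ciInf fun i => (h i).1)

theorem spread_nonneg {n : ℕ} (hn : 0 < n) (x : Fin n → ℝ) : 0 ≤ spread x :=
  sub_nonneg.2 ((ciInf_le (bddBelow_range_fin x) ⟨0, hn⟩).trans
    (le_ciSup (bddAbove_range_fin x) ⟨0, hn⟩))

theorem mem_extrema {n : ℕ} (x : Fin n → ℝ) (i : Fin n) : (⨅ i, x i) ≤ x i ∧ x i ≤ ⨆ i, x i :=
  ⟨ciInf_le (bddBelow_range_fin x) i, le_ciSup (bddAbove_range_fin x) i⟩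

theorem spread_step_le {n : ℕ} (hn : 0 < n) (p : Fin n × Fin n) (a b : Bool) (x : Fin n → ℝ) :
    spread (step p a b x) ≤ spread x := by
  refine spread_le hn fun i => ?_
  have e1 := mem_extrema x p.1
  have e2 := mem_extrema x p.2
  unfold step
  split_ifs
  · constructor <;> linarith
  · exact mem_extrema x i

/-- If `2 * n` consecutive intervals are good for pairs along which the influenced set of some node
grows to everything, then the spread contracts by a factor that depends on `n` and `B` only. -/
theorem spread_contract {n : ℕ} (hn : 0 < n) {s : ℕ → Fin n × Fin n} {a b : ℕ → Bool}
    {y : ℕ → Fin n → ℝ} (hy : ∀ t, y (t + 1) = step (s t) (a t) (b t) (y t))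
    {T : ℕ → ℕ} (hT : Monotone T) {τ : ℕ → Bool} {p : ℕ → Fin n × Fin n}
    {S : ℕ → Finset (Fin n)} {r : Fin n} (hS0 : S 0 = {r})
    (hS : ∀ l, S (l + 1) = S l ∨
      (sender (τ l) (p l) ∈ S l ∧ S (l + 1) = insert (receiver (τ l) (p l)) (S l)))
    {L : ℕ} (hL : S L = Finset.univ) {B : ℕ}
    (hgood : ∀ l < L, Good s a b B (τ l) (p l) (T l) (T (l + 1))) :
    spread (y (T L)) ≤ (1 - 1 / (2 ^ B) ^ L) * spread (y (T 0)) := by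
  set m := ⨅ i, y (T 0) i with hm
  set M := ⨆ i, y (T 0) i with hM
  set v := y (T 0) r with hv
  obtain ⟨hmv, hvM⟩ : m ≤ v ∧ v ≤ M := mem_extrema (y (T 0)) r
  have key : ∀ l ≤ L, Influenced m M v (1 / (2 ^ B) ^ l) (S l) (y (T l)) := by
    intro l
    induction l with
    | zero =>
      refine fun _ => ⟨mem_extrema _, fun i hi => ?_⟩
      rw [hS0, Finset.mem_singleton] at hi
      subst hi
      constructor <;> simp [hv]
    | succ l ih =>
      intro hl
      obtain ⟨hhit, hact⟩ := hgood l hl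
      have hle : 1 / (2 ^ B : ℝ) ^ (l + 1) ≤
          1 / (2 ^ B) ^ l / 2 ^ activity a b (T l) (T (l + 1)) := by
        rw [pow_succ, ← div_div]
        gcongr
        norm_num
      have ih' := ih (by omega)
      rcases hS l with h | ⟨h1, h2⟩
      · rw [h]
        exact (ih'.interval hy hmv hvM (by positivity) (hT (Nat.le_succ l)) (τ l) (p l)).1.mono
          hmv hvM hle
      · rw [h2]
        exact ((ih'.interval hy hmv hvM (by positivity) (hT (Nat.le_succ l)) (τ l) (p l)).2
          h1 hhit).mono hmv hvM hle
  have hfin := key L le_rfl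
  rw [hL] at hfin
  refine (spread_le hn fun i => hfin.2 i (Finset.mem_univ i)).trans (le_of_eq ?_)
  have : spread (y (T 0)) = M - m := rfl
  rw [this]
  ring

/-! ### Measurability and independence -/

section Environment

variable {Ω : Type*} {n : ℕ} {sel : ℕ → Ω → Fin n × Fin n} {rp rm : ℕ → Ω → Bool}

/-- The events that are determined by the selection and the communication at the times in `I`. -/
abbrev history {n : ℕ} (sel : ℕ → Ω → Fin n × Fin n) (rp rm : ℕ → Ω → Bool) (I : Set ℕ) :
    MeasurableSpace Ω :=
  ⨆ k ∈ I, MeasurableSpace.comap (fun ω => (sel k ω, rp k ω, rm k ω)) inferInstance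

theorem history_mono {I J : Set ℕ} (h : I ⊆ J) : history sel rp rm I ≤ history sel rp rm J :=
  biSup_mono h

theorem measurable_history {I : Set ℕ} {k : ℕ} (hk : k ∈ I) :
    Measurable[history sel rp rm I] fun ω => (sel k ω, rp k ω, rm k ω) :=
  Measurable.mono (comap_measurable _) (le_biSup (fun k => MeasurableSpace.comap
    (fun ω => (sel k ω, rp k ω, rm k ω)) inferInstance) hk) le_rfl

theorem measurableSet_history {I : Set ℕ} {k : ℕ} (hk : k ∈ I)
    (Q : Fin n × Fin n → Bool → Bool → Prop) :
    MeasurableSet[history sel rp rm I] {ω | Q (sel k ω) (rp k ω) (rm k ω)} :=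
  measurable_history hk (MeasurableSet.of_discrete
    (s := {z : (Fin n × Fin n) × Bool × Bool | Q z.1 z.2.1 z.2.2}))

theorem measurable_step : Measurable fun q : ((Fin n × Fin n) × Bool × Bool) × (Fin n → ℝ) =>
    step q.1.1 q.1.2.1 q.1.2.2 q.2 := by
  refine measurable_from_prod_countable_right fun z => measurable_pi_lambda _ fun i => ?_
  simp only [step]
  split_ifs <;> fun_prop

theorem measurable_spread : Measurable (spread : (Fin n → ℝ) → ℝ) := by
  unfold spread
  exact (Measurable.iSup fun i => measurable_pi_apply i).sub
    (Measurable.iInf fun i => measurable_pi_apply i)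

/-- The state at time `t` of the algorithm started at time `0`. -/
noncomputable def trajectory (sel : ℕ → Ω → Fin n × Fin n) (rp rm : ℕ → Ω → Bool)
    (x0 : Fin n → ℝ) (t : ℕ) (ω : Ω) : Fin n → ℝ :=
  state (fun k => sel k ω) (fun k => rp k ω) (fun k => rm k ω) 0 x0 t

theorem trajectory_succ (sel : ℕ → Ω → Fin n × Fin n) (rp rm : ℕ → Ω → Bool)
    (x0 : Fin n → ℝ) (t : ℕ) (ω : Ω) :
    trajectory sel rp rm x0 (t + 1) ω =
      step (sel t ω) (rp t ω) (rm t ω) (trajectory sel rp rm x0 t ω) := by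
  simp [trajectory, state]

theorem state_eq_trajectory (sel : ℕ → Ω → Fin n × Fin n) (rp rm : ℕ → Ω → Bool) (k₀ : ℕ)
    (x0 : Fin n → ℝ) (t : ℕ) (ω : Ω) :
    state (fun k => sel k ω) (fun k => rp k ω) (fun k => rm k ω) k₀ x0 t =
      trajectory (fun k => sel (k₀ + k)) (fun k => rp (k₀ + k)) (fun k => rm (k₀ + k)) x0 t ω := by
  induction t with
  | zero => rfl
  | succ t ih => rw [trajectory_succ, ← ih, state]

theorem spread_trajectory_antitone (hn : 0 < n) (sel : ℕ → Ω → Fin n × Fin n)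
    (rp rm : ℕ → Ω → Bool) (x0 : Fin n → ℝ) (ω : Ω) :
    Antitone fun t => spread (trajectory sel rp rm x0 t ω) :=
  antitone_nat_of_succ_le fun t => by
    rw [trajectory_succ]
    exact spread_step_le hn _ _ _ _

theorem measurable_trajectory (x0 : Fin n → ℝ) (t : ℕ) :
    Measurable[history sel rp rm (Set.Iio t)] (trajectory sel rp rm x0 t) := by
  induction t with
  | zero => exact measurable_const
  | succ t ih =>
    have h1 : Measurable[history sel rp rm (Set.Iio (t + 1))] (trajectory sel rp rm x0 t) :=
      ih.mono (history_mono (Set.Iio_subset_Iio (Nat.le_succ t))) le_rfl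
    have h2 : Measurable[history sel rp rm (Set.Iio (t + 1))]
      fun ω => (sel t ω, rp t ω, rm t ω) := measurable_history (Nat.lt_succ_self t)
    have h3 := measurable_step.comp (h2.prodMk h1)
    convert h3 using 1
    funext ω
    exact trajectory_succ ..

theorem measurable_activity {T T' : ℕ} :
    Measurable[history sel rp rm (Set.Ico T T')]
      fun ω => activity (fun k => rp k ω) (fun k => rm k ω) T T' := by
  simp only [activity, Finset.card_filter]
  refine Finset.measurable_fun_sum _ fun k hk => ?_
  refine Measurable.ite (measurableSet_history (k := k) (by simpa using hk)
    fun _ a b => (a || b) = true) measurable_const measurable_const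

theorem measurableSet_good {B : ℕ} {σ : Bool} {p : Fin n × Fin n} {T T' : ℕ} :
    MeasurableSet[history sel rp rm (Set.Ico T T')]
      {ω | Good (fun k => sel k ω) (fun k => rp k ω) (fun k => rm k ω) B σ p T T'} := by
  have : {ω | Good (fun k => sel k ω) (fun k => rp k ω) (fun k => rm k ω) B σ p T T'} =
      (⋃ k ∈ Finset.Ico T T', {ω | sel k ω = p ∧ (bif σ then rp k ω else rm k ω) = true}) ∩
      {ω | activity (fun k => rp k ω) (fun k => rm k ω) T T' ≤ B} := by
    ext ω
    simp only [Good, Hit, Set.mem_inter_iff, Set.mem_iUnion, Set.mem_ofPred_eq, exists_prop]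
  rw [this]
  refine MeasurableSet.inter ?_ (measurable_activity (measurableSet_Iic (a := B)))
  exact Finset.measurableSet_biUnion _ fun k hk => measurableSet_history (by simpa using hk)
    fun s a b => s = p ∧ (bif σ then a else b) = true

variable [mΩ : MeasurableSpace Ω] {A : Matrix (Fin n) (Fin n) ℝ} {Pp Pm : ℕ → ℝ} {μ : Measure Ω}

theorem IsGossipProcess.shift (h : IsGossipProcess A Pp Pm μ sel rp rm) (k₀ : ℕ) :
    IsGossipProcess A (fun k => Pp (k₀ + k)) (fun k => Pm (k₀ + k)) μ
      (fun k => sel (k₀ + k)) (fun k => rp (k₀ + k)) (fun k => rm (k₀ + k)) where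
  measurable_sel _ := h.measurable_sel _
  measurable_rp _ := h.measurable_rp _
  measurable_rm _ := h.measurable_rm _
  sel_law _ := h.sel_law _
  plus_law _ := h.plus_law _
  minus_law _ := h.minus_law _
  indep_time := h.indep_time.precomp (add_right_injective k₀)
  indep_sel_comm _ := h.indep_sel_comm _

theorem IsGossipProcess.comap_le (h : IsGossipProcess A Pp Pm μ sel rp rm) (k : ℕ) :
    MeasurableSpace.comap (fun ω => (sel k ω, rp k ω, rm k ω)) inferInstance ≤ mΩ :=
  ((h.measurable_sel k).prodMk ((h.measurable_rp k).prodMk (h.measurable_rm k))).comap_le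

theorem IsGossipProcess.history_le (h : IsGossipProcess A Pp Pm μ sel rp rm) (I : Set ℕ) :
    history sel rp rm I ≤ mΩ :=
  iSup₂_le fun k _ => h.comap_le k

theorem IsGossipProcess.indep_history (h : IsGossipProcess A Pp Pm μ sel rp rm) {I J : Set ℕ}
    (hIJ : Disjoint I J) : Indep (history sel rp rm I) (history sel rp rm J) μ :=
  indep_iSup_of_disjoint h.comap_le h.indep_time.iIndep hIJ

theorem IsGossipProcess.measurableSet (h : IsGossipProcess A Pp Pm μ sel rp rm) (k : ℕ)
    (Q : Fin n × Fin n → Bool → Bool → Prop) :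
    MeasurableSet {ω | Q (sel k ω) (rp k ω) (rm k ω)} :=
  h.history_le {k} _ (measurableSet_history (Set.mem_singleton k) Q)

/-! ### Good intervals have probability bounded below -/

theorem IsGossipProcess.comm_law (h : IsGossipProcess A Pp Pm μ sel rp rm) (σ : Bool) (k : ℕ) :
    μ.real {ω | (bif σ then rp k ω else rm k ω) = true} = bif σ then Pp k else Pm k := by
  cases σ
  · exact h.minus_law k
  · exact h.plus_law k

theorem IsGossipProcess.plus_nonneg (h : IsGossipProcess A Pp Pm μ sel rp rm) (k : ℕ) :
    0 ≤ Pp k := h.plus_law k ▸ measureReal_nonneg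

theorem IsGossipProcess.minus_nonneg (h : IsGossipProcess A Pp Pm μ sel rp rm) (k : ℕ) :
    0 ≤ Pm k := h.minus_law k ▸ measureReal_nonneg

theorem IsGossipProcess.hit_law (h : IsGossipProcess A Pp Pm μ sel rp rm) (σ : Bool)
    (p : Fin n × Fin n) (k : ℕ) :
    μ.real {ω | sel k ω = p ∧ (bif σ then rp k ω else rm k ω) = true} =
      1 / (n : ℝ) * A p.1 p.2 * (bif σ then Pp k else Pm k) := by
  have h1 := (h.indep_sel_comm k).measure_inter_preimage_eq_mul {p}
    {z : Bool × Bool | (bif σ then z.1 else z.2) = true}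
    (MeasurableSet.of_discrete) (MeasurableSet.of_discrete)
  have h2 := congrArg ENNReal.toReal h1
  rw [ENNReal.toReal_mul] at h2
  rw [← h.comm_law σ k, ← h.sel_law k p.1 p.2]
  exact h2

variable [IsProbabilityMeasure μ]

theorem IsGossipProcess.no_hit_le (h : IsGossipProcess A Pp Pm μ sel rp rm) (σ : Bool)
    (p : Fin n × Fin n) (I : Finset ℕ) :
    μ.real {ω | ∀ k ∈ I, ¬ (sel k ω = p ∧ (bif σ then rp k ω else rm k ω) = true)} ≤
      Real.exp (-(1 / (n : ℝ) * A p.1 p.2 * ∑ k ∈ I, bif σ then Pp k else Pm k)) := by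
  have h1 := h.indep_time.measure_inter_preimage_eq_mul I
    (sets := fun _ => {z | ¬ (z.1 = p ∧ (bif σ then z.2.1 else z.2.2) = true)})
    (fun _ _ => MeasurableSet.of_discrete)
  have h2 := congrArg ENNReal.toReal h1
  rw [ENNReal.toReal_prod] at h2
  have h3 : {ω | ∀ k ∈ I, ¬ (sel k ω = p ∧ (bif σ then rp k ω else rm k ω) = true)} =
      ⋂ k ∈ I, (fun ω => (sel k ω, rp k ω, rm k ω)) ⁻¹'
        {z | ¬ (z.1 = p ∧ (bif σ then z.2.1 else z.2.2) = true)} := by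
    ext ω
    simp
  rw [h3, measureReal_def, h2, Finset.mul_sum, ← Finset.sum_neg_distrib, Real.exp_sum]
  refine Finset.prod_le_prod (fun _ _ => ENNReal.toReal_nonneg) fun k _ => ?_
  have h4 : (fun ω => (sel k ω, rp k ω, rm k ω)) ⁻¹'
      {z | ¬ (z.1 = p ∧ (bif σ then z.2.1 else z.2.2) = true)} =
      {ω | sel k ω = p ∧ (bif σ then rp k ω else rm k ω) = true}ᶜ := rfl
  rw [← measureReal_def, h4, probReal_compl_eq_one_sub, h.hit_law]
  · exact Real.one_sub_le_exp_neg _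
  · exact h.measurableSet k fun s a b => s = p ∧ (bif σ then a else b) = true

theorem IsGossipProcess.active_le (h : IsGossipProcess A Pp Pm μ sel rp rm) (k : ℕ) :
    μ.real {ω | (rp k ω || rm k ω) = true} ≤ Pp k + Pm k := by
  rw [← h.plus_law, ← h.minus_law]
  refine le_trans (measureReal_mono fun ω hω => ?_) (measureReal_union_le _ _)
  simpa [successEvent] using hω

/-- Markov's inequality for the number of successful transmissions. -/
theorem IsGossipProcess.activity_tail (h : IsGossipProcess A Pp Pm μ sel rp rm) {T T' : ℕ}
    {C : ℝ} (hC : ∑ k ∈ Finset.Ico T T', (Pp k + Pm k) ≤ C) (B : ℕ) :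
    μ.real {ω | B + 1 ≤ activity (fun k => rp k ω) (fun k => rm k ω) T T'} ≤ C / (B + 1) := by
  have hmeas : ∀ k, MeasurableSet {ω | (rp k ω || rm k ω) = true} := fun k =>
    h.measurableSet k fun _ a b => (a || b) = true
  have hsum : (fun ω => (activity (fun k => rp k ω) (fun k => rm k ω) T T' : ℝ)) =
      fun ω => ∑ k ∈ Finset.Ico T T', {ω | (rp k ω || rm k ω) = true}.indicator 1 ω := by
    funext ω
    simp [activity, Set.indicator_apply]
  have hint : ∀ k ∈ Finset.Ico T T',
      Integrable ({ω | (rp k ω || rm k ω) = true}.indicator (1 : Ω → ℝ)) μ := fun k _ =>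
    (integrable_const (1 : ℝ)).indicator (hmeas k)
  have h1 := mul_meas_ge_le_integral_of_nonneg (μ := μ)
    (f := fun ω => (activity (fun k => rp k ω) (fun k => rm k ω) T T' : ℝ))
    (Eventually.of_forall fun ω => Nat.cast_nonneg _)
    (by rw [hsum]; exact integrable_finsetSum _ hint) (B + 1)
  have h2 : ∫ ω, (activity (fun k => rp k ω) (fun k => rm k ω) T T' : ℝ) ∂μ ≤ C := by
    rw [hsum, integral_finsetSum _ hint]
    refine le_trans (Finset.sum_le_sum fun k _ => ?_) hC
    rw [integral_indicator_one (hmeas k)]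
    exact h.active_le k
  rw [le_div_iff₀ (by positivity), mul_comm]
  refine le_trans (le_of_eq ?_) (h1.trans h2)
  norm_cast

theorem IsGossipProcess.good_ge (h : IsGossipProcess A Pp Pm μ sel rp rm) {T T' : ℕ}
    {C c : ℝ} (hC : ∑ k ∈ Finset.Ico T T', (Pp k + Pm k) ≤ C) (σ : Bool) (p : Fin n × Fin n)
    (hc : c ≤ 1 / (n : ℝ) * A p.1 p.2 * ∑ k ∈ Finset.Ico T T', bif σ then Pp k else Pm k)
    (B : ℕ) :
    1 - Real.exp (-c) - C / (B + 1) ≤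
      μ.real {ω | Good (fun k => sel k ω) (fun k => rp k ω) (fun k => rm k ω) B σ p T T'} := by
  have h1 := (h.no_hit_le σ p (Finset.Ico T T')).trans (Real.exp_le_exp.2 (neg_le_neg hc))
  have h2 := h.activity_tail hC B
  have h3 : (Set.univ : Set Ω) ⊆
      {ω | Good (fun k => sel k ω) (fun k => rp k ω) (fun k => rm k ω) B σ p T T'} ∪
      ({ω | ∀ k ∈ Finset.Ico T T', ¬ (sel k ω = p ∧ (bif σ then rp k ω else rm k ω) = true)} ∪
      {ω | B + 1 ≤ activity (fun k => rp k ω) (fun k => rm k ω) T T'}) := by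
    intro ω _
    by_cases ha : B + 1 ≤ activity (fun k => rp k ω) (fun k => rm k ω) T T'
    · exact .inr (.inr ha)
    · by_cases hh : ∀ k ∈ Finset.Ico T T',
        ¬ (sel k ω = p ∧ (bif σ then rp k ω else rm k ω) = true)
      · exact .inr (.inl hh)
      · push Not at hh
        exact .inl ⟨hh, by omega⟩
  have h4 := (measureReal_mono (μ := μ) h3).trans ((measureReal_union_le _ _).trans
    (add_le_add_right (measureReal_union_le _ _) _))
  rw [probReal_univ] at h4
  linarith

/-- Consecutive intervals are good independently of each other. -/
theorem IsGossipProcess.all_good_ge (h : IsGossipProcess A Pp Pm μ sel rp rm) {T : ℕ → ℕ}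
    (hT : Monotone T) {τ : ℕ → Bool} {p : ℕ → Fin n × Fin n} {B : ℕ} {η : ℝ} (hη : 0 ≤ η)
    (hgood : ∀ l, η ≤ μ.real {ω | Good (fun k => sel k ω) (fun k => rp k ω) (fun k => rm k ω)
      B (τ l) (p l) (T l) (T (l + 1))}) (L : ℕ) :
    MeasurableSet[history sel rp rm (Set.Ico (T 0) (T L))]
      {ω | ∀ l < L, Good (fun k => sel k ω) (fun k => rp k ω) (fun k => rm k ω)
        B (τ l) (p l) (T l) (T (l + 1))} ∧
    η ^ L ≤ μ.real {ω | ∀ l < L, Good (fun k => sel k ω) (fun k => rp k ω) (fun k => rm k ω)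
        B (τ l) (p l) (T l) (T (l + 1))} := by
  induction L with
  | zero => simp
  | succ L ih =>
    have hset : {ω | ∀ l < L + 1, Good (fun k => sel k ω) (fun k => rp k ω) (fun k => rm k ω)
        B (τ l) (p l) (T l) (T (l + 1))} =
        {ω | ∀ l < L, Good (fun k => sel k ω) (fun k => rp k ω) (fun k => rm k ω)
        B (τ l) (p l) (T l) (T (l + 1))} ∩
        {ω | Good (fun k => sel k ω) (fun k => rp k ω) (fun k => rm k ω)
        B (τ L) (p L) (T L) (T (L + 1))} := by
      ext ω
      simp only [Set.mem_ofPred_eq, Set.mem_inter_iff, Nat.lt_succ_iff_lt_or_eq]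
      exact ⟨fun h => ⟨fun l hl => h l (.inl hl), h L (.inr rfl)⟩,
        fun h l hl => hl.elim (h.1 l) fun e => e ▸ h.2⟩
    have h0 : T 0 ≤ T L := hT (Nat.zero_le L)
    have h1 : T L ≤ T (L + 1) := hT (Nat.le_succ L)
    rw [hset]
    refine ⟨MeasurableSet.inter (history_mono (Set.Ico_subset_Ico_right h1) _ ih.1)
      (history_mono (Set.Ico_subset_Ico_left h0) _ measurableSet_good), ?_⟩
    have hind := (Indep_iff _ _ _).1 (h.indep_history (I := Set.Ico (T 0) (T L))
      (J := Set.Ico (T L) (T (L + 1)))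
      (by rw [Set.disjoint_left]; rintro x ⟨_, hx⟩ ⟨hx', _⟩; omega))
      _ _ ih.1 (measurableSet_good (B := B) (σ := τ L) (p := p L))
    rw [measureReal_def, hind, ENNReal.toReal_mul, pow_succ]
    exact mul_le_mul ih.2 (hgood L) hη measureReal_nonneg

/-! ### Contraction of the expected spread -/

theorem IsGossipProcess.integrable_spread (h : IsGossipProcess A Pp Pm μ sel rp rm) (hn : 0 < n)
    (x0 : Fin n → ℝ) (t : ℕ) : Integrable (fun ω => spread (trajectory sel rp rm x0 t ω)) μ := by
  refine Integrable.of_bound (C := spread x0) ?_ (Eventually.of_forall fun ω => ?_)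
  · exact (measurable_spread.comp
      ((measurable_trajectory x0 t).mono (h.history_le _) le_rfl)).aestronglyMeasurable
  · rw [Real.norm_of_nonneg (spread_nonneg hn _)]
    exact spread_trajectory_antitone hn sel rp rm x0 ω (Nat.zero_le t)

/-- If an event `E` that is independent of the past of time `t` forces the spread to contract by
the factor `1 - c` between `t` and `t'`, then the expected spread contracts by `1 - c * P(E)`. -/
theorem IsGossipProcess.integral_spread_le (h : IsGossipProcess A Pp Pm μ sel rp rm) (hn : 0 < n)
    (x0 : Fin n → ℝ) {t t' : ℕ} (htt' : t ≤ t') {E : Set Ω}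
    (hE : MeasurableSet[history sel rp rm (Set.Ico t t')] E) {c : ℝ}
    (hc : ∀ ω ∈ E, spread (trajectory sel rp rm x0 t' ω) ≤
      (1 - c) * spread (trajectory sel rp rm x0 t ω)) :
    ∫ ω, spread (trajectory sel rp rm x0 t' ω) ∂μ ≤
      (1 - c * μ.real E) * ∫ ω, spread (trajectory sel rp rm x0 t ω) ∂μ := by
  have hE' : MeasurableSet E := h.history_le _ _ hE
  have hind : IndepFun (fun ω => spread (trajectory sel rp rm x0 t ω))
      (E.indicator (1 : Ω → ℝ)) μ := by
    rw [IndepFun_iff_Indep]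
    refine indep_of_indep_of_le_left (indep_of_indep_of_le_right (h.indep_history
      (I := Set.Iio t) (J := Set.Ico t t') ?_) ?_) ?_
    · rw [Set.disjoint_left]
      rintro x hx ⟨hx', _⟩
      exact absurd hx (not_lt.2 hx')
    · refine Measurable.comap_le ?_
      exact (@measurable_const _ _ _ (history sel rp rm (Set.Ico t t')) (1 : ℝ)).indicator hE
    · exact (measurable_spread.comp (measurable_trajectory x0 t)).comap_le
  have hmul := hind.integral_mul_eq_mul_integral (h.integrable_spread hn x0 t).1
    (measurable_one.indicator hE').aestronglyMeasurable
  rw [integral_indicator_one hE'] at hmul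
  have hint : Integrable (fun ω => spread (trajectory sel rp rm x0 t ω) *
      E.indicator (1 : Ω → ℝ) ω) μ := by
    refine ((h.integrable_spread hn x0 t).indicator hE').congr (Eventually.of_forall fun ω => ?_)
    by_cases hω : ω ∈ E <;> simp [hω]
  have hle : ∫ ω, spread (trajectory sel rp rm x0 t' ω) ∂μ ≤
      ∫ ω, (spread (trajectory sel rp rm x0 t ω) - c * (spread (trajectory sel rp rm x0 t ω) *
        E.indicator (1 : Ω → ℝ) ω)) ∂μ := by
    refine integral_mono (h.integrable_spread hn x0 t')
      ((h.integrable_spread hn x0 t).sub (hint.const_mul c)) fun ω => ?_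
    by_cases hω : ω ∈ E
    · have := hc ω hω
      simp only [Set.indicator_of_mem hω, Pi.one_apply]
      linarith
    · have := spread_trajectory_antitone hn sel rp rm x0 ω htt'
      simpa [hω] using this
  rw [integral_sub (h.integrable_spread hn x0 t) (hint.const_mul c), integral_const_mul] at hle
  have e : ∫ ω, spread (trajectory sel rp rm x0 t ω) * E.indicator (1 : Ω → ℝ) ω ∂μ =
    (∫ ω, spread (trajectory sel rp rm x0 t ω) ∂μ) * μ.real E := hmul
  rw [e] at hle
  linarith

end Environment

section Consensus

/-! ### Divergence implies consensus -/

/-- The interval that starts at a given time is taken as short as possible, so that its sum exceeds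
`1` by at most one term. -/
theorem exists_intervals {f : ℕ → ℝ} (h2 : ∀ k, f k ≤ 2)
    (hdiv : Tendsto (fun N : ℕ => ∑ k ∈ Finset.range N, f k) atTop atTop) :
    ∃ T : ℕ → ℕ, Monotone T ∧
      ∀ l, 1 ≤ ∑ k ∈ Finset.Ico (T l) (T (l + 1)), f k ∧
        ∑ k ∈ Finset.Ico (T l) (T (l + 1)), f k ≤ 3 := by
  classical
  have hnext : ∀ t, ∃ t', t ≤ t' ∧ 1 ≤ ∑ k ∈ Finset.Ico t t', f k ∧
      ∑ k ∈ Finset.Ico t t', f k ≤ 3 := by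
    intro t
    have hex : ∃ t', t ≤ t' ∧ 1 ≤ ∑ k ∈ Finset.Ico t t', f k := by
      obtain ⟨t', ht', hge⟩ := ((hdiv.eventually_ge_atTop
        (1 + ∑ k ∈ Finset.range t, f k)).and (eventually_ge_atTop t)).exists
      refine ⟨t', hge, ?_⟩
      rw [Finset.sum_Ico_eq_sub _ hge]
      linarith
    obtain ⟨h1, h3⟩ := Nat.find_spec hex
    have hmin := fun m => Nat.find_min hex (m := m)
    generalize Nat.find hex = t' at h1 h3 hmin
    refine ⟨t', h1, h3, ?_⟩
    rcases h1.eq_or_lt with rfl | hlt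
    · simp
    · obtain ⟨u, rfl⟩ : ∃ u, t' = u + 1 := ⟨t' - 1, by omega⟩
      have hu : t ≤ u := by omega
      have := hmin u (Nat.lt_succ_self u)
      push Not at this
      rw [Finset.sum_Ico_succ_top hu]
      linarith [this hu, h2 u]
  choose F hF using hnext
  exact ⟨fun l => F^[l] 0, monotone_nat_of_le_succ fun l => by
    rw [Function.iterate_succ_apply']; exact (hF _).1, fun l => by
    simp only [Function.iterate_succ_apply']; exact (hF _).2⟩

theorem exists_weight_bound {n : ℕ} (hn : 0 < n) {G₀ : Digraph (Fin n)}
    {A : Matrix (Fin n) (Fin n) ℝ} (hA : IsSelectionMatrix G₀ A) :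
    ∃ w > 0, ∀ p : Fin n × Fin n, 0 < A p.1 p.2 → w ≤ 1 / (n : ℝ) * A p.1 p.2 := by
  obtain ⟨j, hj⟩ := exists_pos_weight hA ⟨0, hn⟩
  obtain ⟨q, hq, hmin⟩ := Finset.exists_min_image
    (Finset.univ.filter fun p : Fin n × Fin n => 0 < A p.1 p.2)
    (fun p => 1 / (n : ℝ) * A p.1 p.2) ⟨(⟨0, hn⟩, j), by simpa using hj⟩
  have hq' : 0 < A q.1 q.2 := by simpa using hq
  exact ⟨1 / (n : ℝ) * A q.1 q.2, by positivity, fun p hp => hmin p (by simpa using hp)⟩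

variable {Ω : Type*} [MeasurableSpace Ω] {n : ℕ} {A : Matrix (Fin n) (Fin n) ℝ} {Pp Pm : ℕ → ℝ}
  {μ : Measure Ω} {sel : ℕ → Ω → Fin n × Fin n} {rp rm : ℕ → Ω → Bool} [IsProbabilityMeasure μ]

/-- If the expected number of successful transmissions (counted with direction) in each of the
intervals `[T l, T (l + 1))` lies between `1` and `3`, then the expected spread contracts by a
fixed factor over `2 * n` intervals. -/
theorem IsGossipProcess.exists_contraction (h : IsGossipProcess A Pp Pm μ sel rp rm) (hn : 0 < n)
    {G₀ : Digraph (Fin n)} (hA : IsSelectionMatrix G₀ A) (hconn : DoublyConnected G₀)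
    {T : ℕ → ℕ} (hT : Monotone T)
    (hsum : ∀ l, 1 ≤ ∑ k ∈ Finset.Ico (T l) (T (l + 1)), (Pp k + Pm k) ∧
        ∑ k ∈ Finset.Ico (T l) (T (l + 1)), (Pp k + Pm k) ≤ 3) (x0 : Fin n → ℝ) :
    ∃ ρ : ℝ, 0 ≤ ρ ∧ ρ < 1 ∧ ∀ l,
      ∫ ω, spread (trajectory sel rp rm x0 (T (l + 2 * n)) ω) ∂μ ≤
        ρ * ∫ ω, spread (trajectory sel rp rm x0 (T l) ω) ∂μ := by
  obtain ⟨w, hw, hwA⟩ := exists_weight_bound hn hA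
  have hτ : ∀ l, ∃ σ : Bool,
      1 / 2 ≤ ∑ k ∈ Finset.Ico (T l) (T (l + 1)), bif σ then Pp k else Pm k := by
    intro l
    have := (hsum l).1
    rw [Finset.sum_add_distrib] at this
    by_contra! hcon
    have h1 := hcon true
    have h2 := hcon false
    simp only [cond_true, cond_false] at h1 h2
    linarith
  choose τ hτ using hτ
  set δ := 1 - Real.exp (-(w / 2)) with hδ
  have hδ0 : 0 < δ := by
    have : Real.exp (-(w / 2)) < 1 := by
      rw [← Real.exp_zero]
      exact Real.exp_lt_exp.2 (by linarith)
    linarith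
  -- `B` is so large that more than `B` transmissions have probability at most `δ / 2`
  obtain ⟨B, hB⟩ := exists_nat_gt (6 / δ)
  have hB' : (3 : ℝ) / (B + 1) ≤ δ / 2 := by
    rw [div_lt_iff₀ hδ0] at hB
    rw [div_le_iff₀ (by positivity)]
    nlinarith
  have hδ1 : δ ≤ 1 := by
    have := Real.exp_pos (-(w / 2))
    linarith
  have hgood : ∀ l (p : Fin n × Fin n), 0 < A p.1 p.2 → δ / 2 ≤
      μ.real {ω | Good (fun k => sel k ω) (fun k => rp k ω) (fun k => rm k ω)
        B (τ l) p (T l) (T (l + 1))} := by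
    intro l p hp
    refine le_trans ?_ (h.good_ge (hsum l).2 (τ l) p (c := w / 2) ?_ B)
    · linarith
    · have := mul_le_mul (hwA p hp) (hτ l) (by norm_num) (hw.le.trans (hwA p hp))
      linarith
  set κ : ℝ := 1 / (2 ^ B) ^ (2 * n) with hκ
  have hκ0 : 0 < κ := by positivity
  have hκ1 : κ ≤ 1 := by
    rw [hκ, div_le_one (by positivity)]
    exact one_le_pow₀ (one_le_pow₀ (by norm_num))
  have hq0 : 0 < (δ / 2) ^ (2 * n) := by positivity
  have hq1 : (δ / 2) ^ (2 * n) ≤ 1 := pow_le_one₀ (by positivity) (by linarith)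
  refine ⟨1 - κ * (δ / 2) ^ (2 * n), ?_, ?_, fun l => ?_⟩
  · nlinarith
  · nlinarith
  obtain ⟨r, p, S, hp, hS0, hS, hSL⟩ := exists_pairs_growing hn hA hconn fun j => τ (l + j)
  have hTl : Monotone fun j => T (l + j) := fun i j hij => hT (by omega)
  obtain ⟨hmeas, hprob⟩ := h.all_good_ge hTl (τ := fun j => τ (l + j)) (p := p) (B := B)
    (η := δ / 2) (by positivity) (fun j => hgood (l + j) (p j) (hp j)) (2 * n)
  refine (h.integral_spread_le hn x0 (hT (Nat.le_add_right l (2 * n))) hmeas (c := κ)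
    fun ω hω => ?_).trans ?_
  · exact spread_contract hn (y := fun t => trajectory sel rp rm x0 t ω)
      (fun t => trajectory_succ sel rp rm x0 t ω) hTl hS0 hS hSL hω
  · refine mul_le_mul_of_nonneg_right ?_ (integral_nonneg fun ω => spread_nonneg hn _)
    have := mul_le_mul_of_nonneg_left hprob hκ0.le
    linarith

theorem IsGossipProcess.tendsto_spread (h : IsGossipProcess A Pp Pm μ sel rp rm) (hn : 0 < n)
    {G₀ : Digraph (Fin n)} (hA : IsSelectionMatrix G₀ A) (hconn : DoublyConnected G₀)
    (hdiv : Tendsto (fun N : ℕ => ∑ k ∈ Finset.range N, (Pp k + Pm k)) atTop atTop)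
    (x0 : Fin n → ℝ) :
    ∀ᵐ ω ∂μ, Tendsto (fun t => spread (trajectory sel rp rm x0 t ω)) atTop (𝓝 0) := by
  obtain ⟨T, hT, hsum⟩ := exists_intervals (f := fun k => Pp k + Pm k) (fun k => by
    have h1 : Pp k ≤ 1 := h.plus_law k ▸ measureReal_le_one
    have h2 : Pm k ≤ 1 := h.minus_law k ▸ measureReal_le_one
    linarith) hdiv
  obtain ⟨ρ, hρ0, hρ1, hρ⟩ := h.exists_contraction hn hA hconn hT hsum x0
  set I : ℕ → ℝ := fun t => ∫ ω, spread (trajectory sel rp rm x0 t ω) ∂μ with hI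
  have hI0 : ∀ t, 0 ≤ I t := fun t => integral_nonneg fun ω => spread_nonneg hn _
  have hanti : Antitone I := fun s t hst =>
    integral_mono (h.integrable_spread hn x0 t) (h.integrable_spread hn x0 s) fun ω =>
      spread_trajectory_antitone hn sel rp rm x0 ω hst
  have hgeom : ∀ b, I (T (2 * n * b)) ≤ ρ ^ b * I (T 0) := by
    intro b
    induction b with
    | zero => simp
    | succ b ih =>
      refine (hρ (2 * n * b)).trans ?_
      rw [pow_succ', mul_assoc ρ]
      exact mul_le_mul_of_nonneg_left ih hρ0
  have hlim : Tendsto I atTop (𝓝 0) := by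
    have hpow : Tendsto (fun b => ρ ^ b * I (T 0)) atTop (𝓝 0) := by
      simpa using (tendsto_pow_atTop_nhds_zero_of_lt_one hρ0 hρ1).mul_const (I (T 0))
    rw [Metric.tendsto_atTop]
    intro ε hε
    obtain ⟨b, hb⟩ := (hpow.eventually_lt_const hε).exists
    refine ⟨T (2 * n * b), fun t ht => ?_⟩
    rw [Real.dist_0_eq_abs, abs_of_nonneg (hI0 t)]
    exact ((hanti ht).trans (hgeom b)).trans_lt hb
  exact tendsto_of_integral_tendsto_of_antitone (F := fun _ => (0 : ℝ))
    (fun t => h.integrable_spread hn x0 t) (integrable_const 0) (by simpa using hlim)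
    (Eventually.of_forall fun ω => spread_trajectory_antitone hn sel rp rm x0 ω)
    (Eventually.of_forall fun ω t => spread_nonneg hn _)

/-! ### Consensus implies divergence -/

theorem step_of_eq {p : Fin n × Fin n} {x : Fin n → ℝ} (hx : x p.1 = x p.2) (a b : Bool) :
    step p a b x = x := by
  funext i
  unfold step
  split_ifs with h
  · rcases h with ⟨rfl, -⟩ | ⟨rfl, -⟩ <;> linarith
  · rfl

/-- If the expected number of successful transmissions is finite, then for each `p` of positive
weight it has positive probability that at each time either `p` is selected or nothing is
transmitted. -/
theorem IsGossipProcess.pair_or_silent_pos (h : IsGossipProcess A Pp Pm μ sel rp rm) (hn : 0 < n)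
    (hsum : Summable fun k => Pp k + Pm k) {p : Fin n × Fin n} (hp : 0 < A p.1 p.2) :
    0 < μ {ω | ∀ k, sel k ω = p ∨ (rp k ω || rm k ω) = false} := by
  have hnn : ∀ k, 0 ≤ Pp k + Pm k := fun k => add_nonneg (h.plus_nonneg k) (h.minus_nonneg k)
  obtain ⟨T, hT⟩ := ((tendsto_sum_nat_add fun k => Pp k + Pm k).eventually_lt_const
    (show (0 : ℝ) < 1 by norm_num)).exists
  -- `p` is selected at all times before `T`
  have hpast : 0 < μ {ω | ∀ k ∈ Finset.range T, sel k ω = p} := by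
    have h1 := h.indep_time.measure_inter_preimage_eq_mul (Finset.range T)
      (sets := fun _ => {z | z.1 = p}) (fun _ _ => MeasurableSet.of_discrete)
    have h2 : {ω | ∀ k ∈ Finset.range T, sel k ω = p} =
        ⋂ k ∈ Finset.range T, (fun ω => (sel k ω, rp k ω, rm k ω)) ⁻¹' {z | z.1 = p} := by
      ext ω
      simp
    rw [h2, h1, pos_iff_ne_zero, Finset.prod_ne_zero_iff]
    intro k _ h0
    have h3 := h.sel_law k p.1 p.2
    have h4 : μ.real {ω | sel k ω = (p.1, p.2)} = 0 := by
      rw [measureReal_def]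
      exact (congrArg ENNReal.toReal h0).trans rfl
    rw [h4] at h3
    have : 0 < 1 / (n : ℝ) * A p.1 p.2 := by positivity
    linarith
  -- nothing is transmitted from time `T` on
  have hfut : 0 < μ {ω | ∀ k, (rp (k + T) ω || rm (k + T) ω) = false} := by
    have hcompl : {ω | ∀ k, (rp (k + T) ω || rm (k + T) ω) = false}ᶜ =
        ⋃ k, {ω | (rp (k + T) ω || rm (k + T) ω) = true} := by
      ext ω
      simp only [Set.mem_compl_iff, Set.mem_ofPred_eq, Set.mem_iUnion, not_forall,
        Bool.not_eq_false]
    have hlt : μ {ω | ∀ k, (rp (k + T) ω || rm (k + T) ω) = false}ᶜ < 1 := by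
      rw [hcompl]
      calc μ (⋃ k, {ω | (rp (k + T) ω || rm (k + T) ω) = true})
          ≤ ∑' k, μ {ω | (rp (k + T) ω || rm (k + T) ω) = true} := measure_iUnion_le _
        _ ≤ ∑' k, ENNReal.ofReal (Pp (k + T) + Pm (k + T)) := by
            refine ENNReal.tsum_le_tsum fun k => ?_
            rw [← ofReal_measureReal]
            exact ENNReal.ofReal_le_ofReal (h.active_le (k + T))
        _ = ENNReal.ofReal (∑' k, (Pp (k + T) + Pm (k + T))) :=
            (ENNReal.ofReal_tsum_of_nonneg (fun k => hnn _)
              ((summable_nat_add_iff T).2 hsum)).symm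
        _ < 1 := by
            rw [ENNReal.ofReal_lt_one]
            exact hT
    rw [pos_iff_ne_zero]
    intro h0
    have h1 := measure_univ_le_add_compl (μ := μ)
      {ω | ∀ k, (rp (k + T) ω || rm (k + T) ω) = false}
    rw [h0, zero_add, measure_univ] at h1
    exact absurd hlt (not_lt.2 h1)
  have hind := (Indep_iff _ _ _).1 (h.indep_history (I := Set.Iio T) (J := Set.Ici T)
    (by rw [Set.disjoint_left]; intro x hx hx'; exact not_lt.2 (Set.mem_Ici.1 hx') (Set.mem_Iio.1 hx)))
    {ω | ∀ k ∈ Finset.range T, sel k ω = p}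
    {ω | ∀ k, (rp (k + T) ω || rm (k + T) ω) = false} ?_ ?_
  · refine lt_of_lt_of_le (ENNReal.mul_pos hpast.ne' hfut.ne') (hind ▸ measure_mono ?_)
    rintro ω ⟨h1, h2⟩ k
    by_cases hk : k < T
    · exact .inl (h1 k (Finset.mem_range.2 hk))
    · right
      have := h2 (k - T)
      rwa [Nat.sub_add_cancel (not_lt.1 hk)] at this
  · have : {ω | ∀ k ∈ Finset.range T, sel k ω = p} =
        ⋂ k ∈ Finset.range T, {ω | sel k ω = p} := by
      ext ω
      simp
    rw [this]
    refine Finset.measurableSet_biInter _ fun k hk => ?_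
    have hk' : k ∈ Set.Iio T := Set.mem_Iio.2 (Finset.mem_range.1 hk)
    exact measurableSet_history hk' fun s _ _ => s = p
  · rw [Set.ofPred_forall]
    refine MeasurableSet.iInter fun k => ?_
    have hk : k + T ∈ Set.Ici T := Set.mem_Ici.2 (Nat.le_add_left T k)
    exact measurableSet_history hk fun _ a b => (a || b) = false

theorem spread_single_pos (hn : 2 ≤ n) (m : Fin n) :
    0 < spread (Pi.single m (1 : ℝ) : Fin n → ℝ) := by
  have : Nontrivial (Fin n) := Fin.nontrivial_iff_two_le.2 hn
  obtain ⟨i, hi⟩ := exists_ne m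
  have h1 := (mem_extrema (Pi.single m (1 : ℝ) : Fin n → ℝ) m).2
  have h2 := (mem_extrema (Pi.single m (1 : ℝ) : Fin n → ℝ) i).1
  rw [Pi.single_eq_same] at h1
  rw [Pi.single_eq_of_ne hi] at h2
  unfold spread
  linarith

/-- If the expected number of successful transmissions is finite, then for some initial condition
the state never changes, with positive probability: only two of the at least three nodes ever
communicate, and these two start with the same value, different from that of a third node. -/
theorem IsGossipProcess.exists_not_tendsto (h : IsGossipProcess A Pp Pm μ sel rp rm) (hn : 3 ≤ n)
    {G₀ : Digraph (Fin n)} (hA : IsSelectionMatrix G₀ A)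
    (hsum : Summable fun k => Pp k + Pm k) :
    ∃ x0 : Fin n → ℝ,
      ¬ ∀ᵐ ω ∂μ, Tendsto (fun t => spread (trajectory sel rp rm x0 t ω)) atTop (𝓝 0) := by
  obtain ⟨j, hj⟩ := exists_pos_weight hA ⟨0, by omega⟩
  set i : Fin n := ⟨0, by omega⟩
  obtain ⟨m, hm⟩ : ∃ m, m ∉ ({i, j} : Finset (Fin n)) := by
    by_contra! hall
    have h1 : ({i, j} : Finset (Fin n)) = Finset.univ := Finset.eq_univ_iff_forall.2 hall
    have h2 := Finset.card_le_two (a := i) (b := j)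
    rw [h1, Finset.card_univ, Fintype.card_fin] at h2
    omega
  simp only [Finset.mem_insert, Finset.mem_singleton, not_or] at hm
  refine ⟨Pi.single m 1, fun hae => ?_⟩
  refine (h.pair_or_silent_pos (by omega) hsum (p := (i, j)) hj).ne'
    (measure_mono_null ?_ (ae_iff.1 hae))
  intro ω hω hlim
  have hconst : ∀ t, trajectory sel rp rm (Pi.single m 1) t ω = Pi.single m 1 := by
    intro t
    induction t with
    | zero => rfl
    | succ t ih =>
      rw [trajectory_succ, ih]
      rcases hω t with ht | ht
      · refine step_of_eq ?_ _ _
        rw [ht, Pi.single_eq_of_ne (Ne.symm hm.1), Pi.single_eq_of_ne (Ne.symm hm.2)]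
      · exact step_of_silent _ ht _
  simp only [hconst] at hlim
  exact (spread_single_pos (by omega) m).ne' (tendsto_nhds_unique tendsto_const_nhds hlim)

end Consensus

end Gossip

theorem theorem4 {n : ℕ} (hn : 3 ≤ n)
    (G₀ : Digraph (Fin n)) (A : Matrix (Fin n) (Fin n) ℝ)
    (hA : Gossip.IsSelectionMatrix G₀ A)
    (Pp Pm : ℕ → ℝ)
    {Ω : Type*} [MeasurableSpace Ω] (μ : Measure Ω) [IsProbabilityMeasure μ]
    (sel : ℕ → Ω → Fin n × Fin n) (rp rm : ℕ → Ω → Bool)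
    (hproc : Gossip.IsGossipProcess A Pp Pm μ sel rp rm)
    (hindep : Gossip.IndependentCommunication μ rp rm)
    (hconn : Gossip.DoublyConnected G₀)
    (k₀ : ℕ) :
    Gossip.GlobalASConsensus μ sel rp rm k₀ ↔
      Tendsto (fun N : ℕ => ∑ k ∈ Finset.range N, (Pp k + Pm k)) atTop atTop := by
  have hshift := hproc.shift k₀
  have hnn : ∀ k, 0 ≤ Pp k + Pm k := fun k =>
    add_nonneg (hproc.plus_nonneg k) (hproc.minus_nonneg k)
  -- the first `k₀` terms do not affect the divergence of the series
  have hsummable : (Summable fun k => Pp (k₀ + k) + Pm (k₀ + k)) ↔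
      Summable fun k => Pp k + Pm k := by
    simpa only [add_comm k₀] using summable_nat_add_iff (f := fun k => Pp k + Pm k) k₀
  unfold Gossip.GlobalASConsensus
  simp only [Gossip.state_eq_trajectory]
  rw [← not_summable_iff_tendsto_nat_atTop_of_nonneg hnn, ← hsummable]
  constructor
  · intro hcons hsum
    obtain ⟨x0, hx0⟩ := hshift.exists_not_tendsto hn hA hsum
    exact hx0 (hcons x0)
  · intro hdiv x0
    exact hshift.tendsto_spread (by omega) hA hconn
      ((not_summable_iff_tendsto_nat_atTop_of_nonneg fun k => hnn (k₀ + k)).1 hdiv) x0
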